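/- Let $n\ge 0$ be an integer and let $\mu$ be a centered log-concave Borel probability measure on $\mathbb R^n$; that is, $\mu(\lambda A+(1-\lambda)B)\ge \mu(A)^{\lambda}\mu(B)^{1-\lambda}$ for all compact $A,B\subseteq\mathbb R^n$ and all $\lambda\in(0,1)$, and $\int_{\mathbb R^n}\langle x,\xi\rangle\,d\mu(x)=0$ for every $\xi\in\mathbb R^n$. For $t\ge 1$ let $Z_t^+(\mu)$ be the one-sided $L_t$-centroid body of $\mu$, i.e. the compact convex set with support function $$h_{Z_t^+(\mu)}(y)=\Big(2\int_{\mathbb R^n}\langle x,y\rangle_+^t\,d\mu(x)\Big)^{1/t},\qquad y\in\mathbb R^n,$$ where $a_+=\max\{a,0\}$. Let $$\Lambda_\mu(\xi)=\ln\Big(\int_{\mathbb R^n}e^{\langle \xi,z\rangle}\,d\mu(z)\Big)\in(-\infty,\infty],\qquad \Lambda_\mu^*(x)=\sup_{\xi\in\mathbb R^n}\{\langle x,\xi\rangle-\Lambda_\mu(\xi)\}$$ be the logarithmic Laplace transform and the Cramer transform of $\mu$. Assume that there exists an increasing (not necessarily strictly) function $g:[1,\infty)\to[1,\infty)$ with $\lim_{t\to\infty}g(t)/\ln(t+1)=+\infty$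 such that $$Z_t^+(\mu)\supseteq g(t)\,Z_2^+(\mu)\qquad\text{for all } t\ge 2.$$ Then $$\int_{\mathbb R^n}|\Lambda_\mu^*(x)|^p\,d\mu(x)<+\infty\qquad\text{for every real } p\ge 1.$$ -/

import Mathlib

open MeasureTheory Filter Set
open scoped Pointwise ENNReal RealInnerProductSpace

/-- A Borel measure on `ℝⁿ` is log-concave if
`μ(lA + (1-l)B) ≥ μ(A)^l μ(B)^(1-l)` for all compact `A, B` and all `l ∈ (0,1)`. -/
def IsLogConcaveMeasure {n : ℕ} (μ : Measure (EuclideanSpace ℝ (Fin n))) : Prop :=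
  ∀ A B : Set (EuclideanSpace ℝ (Fin n)), IsCompact A → IsCompact B →
    ∀ l : ℝ, 0 < l → l < 1 → μ A ^ l * μ B ^ (1 - l) ≤ μ (l • A + (1 - l) • B)

/-- The measure is centered: all linear functionals have mean zero.  (Log-concave probability
measures have finite first moments, so the Bochner integral is meaningful for them.) -/
def IsCenteredMeasure {n : ℕ} (μ : Measure (EuclideanSpace ℝ (Fin n))) : Prop :=
  ∀ ξ : EuclideanSpace ℝ (Fin n), ∫ x, ⟪x, ξ⟫ ∂μ = 0

/-- The logarithmic Laplace transform `Λ_μ(ξ) = ln ∫ e^⟨ξ,z⟩ dμ(z)`, with values in `[-∞, ∞]`. -/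
noncomputable def logLaplace {n : ℕ} (μ : Measure (EuclideanSpace ℝ (Fin n)))
    (ξ : EuclideanSpace ℝ (Fin n)) : EReal :=
  ENNReal.log (∫⁻ z, ENNReal.ofReal (Real.exp ⟪ξ, z⟫) ∂μ)

/-- The Cramer transform `Λ*_μ(x) = sup_ξ (⟨x,ξ⟩ - Λ_μ(ξ))`, with values in `[-∞, ∞]`. -/
noncomputable def cramerTransform {n : ℕ} (μ : Measure (EuclideanSpace ℝ (Fin n)))
    (x : EuclideanSpace ℝ (Fin n)) : EReal :=
  ⨆ ξ : EuclideanSpace ℝ (Fin n), ((⟪x, ξ⟫ : ℝ) : EReal) - logLaplace μ ξ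

/-- The function `h(y) = (2 ∫ ⟨x,y⟩₊^t dμ(x))^(1/t)`. -/
noncomputable def oneSidedCentroidSupport {n : ℕ} (μ : Measure (EuclideanSpace ℝ (Fin n)))
    (t : ℝ) (y : EuclideanSpace ℝ (Fin n)) : ℝ :=
  (2 * ∫ x, (max ⟪x, y⟫ 0) ^ t ∂μ) ^ (1 / t)

/-- The one-sided `L_t`-centroid body `Z_t^+(μ)`: the closed convex set with support function
`h = oneSidedCentroidSupport μ t`.  (For `t ≥ 1` and finite moments `h` is sublinear, so this
intersection of half-spaces is the unique closed convex set with support function `h`.) -/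
def oneSidedCentroidBody {n : ℕ} (μ : Measure (EuclideanSpace ℝ (Fin n))) (t : ℝ) :
    Set (EuclideanSpace ℝ (Fin n)) :=
  {x | ∀ y : EuclideanSpace ℝ (Fin n), ⟪x, y⟫ ≤ oneSidedCentroidSupport μ t y}

/-- The Cramer transform is Borel measurable, so integrals of it are meaningful. -/
theorem measurable_cramerTransform {n : ℕ} (μ : Measure (EuclideanSpace ℝ (Fin n))) :
    Measurable (cramerTransform μ) := by
  refine LowerSemicontinuous.measurable ?_
  refine lowerSemicontinuous_iSup fun ξ => Continuous.lowerSemicontinuous ?_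
  have h1 : Continuous fun x : EuclideanSpace ℝ (Fin n) => ((⟪x, ξ⟫ : ℝ) : EReal) :=
    continuous_coe_real_ereal.comp (by fun_prop)
  rw [continuous_iff_continuousAt]
  intro x
  simp only [sub_eq_add_neg]
  have h2 := EReal.continuousAt_add (p := (((⟪x, ξ⟫ : ℝ) : EReal), -logLaplace μ ξ))
    (Or.inl (EReal.coe_ne_top _)) (Or.inl (EReal.coe_ne_bot _))
  have h3 : ContinuousAt (fun x : EuclideanSpace ℝ (Fin n) =>
      (((⟪x, ξ⟫ : ℝ) : EReal), -logLaplace μ ξ)) x :=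
    h1.continuousAt.prodMk continuousAt_const
  exact ContinuousAt.comp (f := fun x : EuclideanSpace ℝ (Fin n) =>
      (((⟪x, ξ⟫ : ℝ) : EReal), -logLaplace μ ξ)) h2 h3

/-! By Markov's inequality, `Λ*(x) ≤ B` as soon as every half-space `⟨z,ξ⟩ ≥ ⟨x,ξ⟩` has mass at
least `e^{-B}`. Log-concavity makes the tails of a linear functional decay geometrically past a
quantile. So if `a = ⟨x,ξ⟩ > 0` and this half-space has mass at most `e^{-2t} μ(⟨z,ξ⟩ ≥ 0)`, then
the support function of `Z_t^+` at `ξ` is at most `12a`. Hence `13x ∈ Z_t^+` forces `Λ*(x) ≤ kt` for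
a constant `k`.

Centering and compactness show that `Z_2^+` contains a ball of a subspace `V` carrying `μ`. The
assumed inclusion then puts `13x` in `Z_t^+` once `g(t)` exceeds a multiple of `‖x‖`. As `g`
outgrows every multiple of the logarithm, `t = T e^{c‖x‖/p}` suffices. Thus `Λ*^p` is a.e. at most a
constant times `e^{c‖x‖}`, which is integrable for a small `c` by log-concavity. -/

/-! ### Half-space tails and exponential moments -/

/-- Log-concavity of a measure passes from compact sets to closed sets. -/
theorem IsLogConcaveMeasure.rpow_mul_rpow_le {n : ℕ} {μ : Measure (EuclideanSpace ℝ (Fin n))}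
    [IsProbabilityMeasure μ] (hlc : IsLogConcaveMeasure μ)
    {A B C : Set (EuclideanSpace ℝ (Fin n))} (hA : IsClosed A) (hB : IsClosed B)
    {l : ℝ} (h0 : 0 < l) (h1 : l < 1) (hC : l • A + (1 - l) • B ⊆ C) :
    μ A ^ l * μ B ^ (1 - l) ≤ μ C := by
  have key : ∀ S : Set (EuclideanSpace ℝ (Fin n)),
      Tendsto (fun M : ℕ => μ (S ∩ Metric.closedBall 0 M)) atTop (nhds (μ S)) := by
    intro S
    have hm : Monotone fun M : ℕ => S ∩ Metric.closedBall (0 : EuclideanSpace ℝ (Fin n)) M :=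
      fun M N h => inter_subset_inter_right _ (Metric.closedBall_subset_closedBall (by exact_mod_cast h))
    have h := tendsto_measure_iUnion_atTop (μ := μ) hm
    rwa [← inter_iUnion, Metric.iUnion_closedBall_nat, inter_univ] at h
  have hlim := ENNReal.Tendsto.mul ((key A).ennrpow_const l)
    (Or.inr (ENNReal.rpow_ne_top_of_nonneg (by linarith) (measure_ne_top μ B)))
    ((key B).ennrpow_const (1 - l))
    (Or.inr (ENNReal.rpow_ne_top_of_nonneg h0.le (measure_ne_top μ A)))
  refine le_of_tendsto' hlim fun M => ?_
  refine (hlc _ _ ((isCompact_closedBall 0 (M : ℝ)).inter_left hA)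
    ((isCompact_closedBall 0 (M : ℝ)).inter_left hB) l h0 h1).trans (measure_mono ?_)
  refine Subset.trans (add_subset_add ?_ ?_) hC <;> exact smul_set_mono inter_subset_left

/-- The tails of a linear functional under a log-concave measure decay geometrically. -/
theorem IsLogConcaveMeasure.measure_mul_le_inner {n : ℕ} {μ : Measure (EuclideanSpace ℝ (Fin n))}
    [IsProbabilityMeasure μ] (hlc : IsLogConcaveMeasure μ) (y : EuclideanSpace ℝ (Fin n))
    {a m : ℝ} (h : μ {x | a ≤ ⟪x, y⟫} ≤ μ {x | 0 ≤ ⟪x, y⟫} * ENNReal.ofReal (Real.exp (-m)))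
    (ha : 0 < a) {k : ℕ} (hk : 1 ≤ k) :
    μ {x | k * a ≤ ⟪x, y⟫} ≤ ENNReal.ofReal (Real.exp (-(m * k))) := by
  have hk0 : (0 : ℝ) < k := by exact_mod_cast hk
  have hle : μ {x | k * a ≤ ⟪x, y⟫} ≤ μ {x | 0 ≤ ⟪x, y⟫} :=
    measure_mono fun x hx => le_trans (by positivity) (mem_ofPred.1 hx)
  rcases eq_or_ne (μ {x | 0 ≤ ⟪x, y⟫}) 0 with h0 | h0
  · rw [h0] at hle
    exact hle.trans zero_le
  have hpow : ENNReal.ofReal (Real.exp (-(m * k))) = ENNReal.ofReal (Real.exp (-m)) ^ (k : ℝ) := by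
    rw [ENNReal.ofReal_rpow_of_pos (Real.exp_pos _), ← Real.exp_mul, neg_mul]
  rcases hk.eq_or_lt with rfl | hk1
  · rw [hpow]
    simpa using h.trans (mul_le_of_le_one_left zero_le prob_le_one)
  have hl1 : (1 : ℝ) / k < 1 := by
    rw [div_lt_one hk0]; exact_mod_cast hk1
  have hc : ∀ s : ℝ, IsClosed {x : EuclideanSpace ℝ (Fin n) | s ≤ ⟪x, y⟫} := fun s =>
    isClosed_le continuous_const (by fun_prop)
  -- With `F(s) = μ(⟨x,y⟩ ≥ s)`, this is `F(ka)^{1/k} F(0)^{1-1/k} ≤ F(a)`. The hypothesis on `F(a)`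
  -- is relative to `F(0)`, so the power of `F(0)` cancels.
  have h2 := hlc.rpow_mul_rpow_le (hc (k * a)) (hc 0) (C := {x | a ≤ ⟪x, y⟫})
    (l := 1 / k) (by positivity) hl1 (by
      rintro _ ⟨_, ⟨u, hu, rfl⟩, _, ⟨v, hv, rfl⟩, rfl⟩
      simp only [mem_ofPred_eq, inner_add_left, real_inner_smul_left] at hu hv ⊢
      have e1 : 1 / (k : ℝ) * (k * a) ≤ 1 / k * ⟪u, y⟫ := by gcongr
      have e2 : 0 ≤ (1 - 1 / (k : ℝ)) * ⟪v, y⟫ := mul_nonneg (by linarith) hv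
      have e3 : 1 / (k : ℝ) * (k * a) = a := by field_simp
      linarith)
  set F0 := μ {x | 0 ≤ ⟪x, y⟫}
  have hF0 : F0 ≠ ∞ := measure_ne_top _ _
  have hsplit : F0 = F0 ^ (1 / (k : ℝ)) * F0 ^ (1 - 1 / (k : ℝ)) := by
    rw [← ENNReal.rpow_add _ _ h0 hF0]; simp
  have h3 : μ {x | k * a ≤ ⟪x, y⟫} ^ (1 / (k : ℝ)) * F0 ^ (1 - 1 / (k : ℝ)) ≤
      (F0 ^ (1 / (k : ℝ)) * ENNReal.ofReal (Real.exp (-m))) * F0 ^ (1 - 1 / (k : ℝ)) := by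
    refine (h2.trans h).trans_eq ?_
    nth_rewrite 1 [hsplit]
    ring
  rw [ENNReal.mul_le_mul_iff_left (ENNReal.rpow_pos (pos_iff_ne_zero.2 h0) hF0).ne'
    (ENNReal.rpow_ne_top_of_nonneg (by linarith) hF0)] at h3
  have h4 : μ {x | k * a ≤ ⟪x, y⟫} ^ (1 / (k : ℝ)) ≤ ENNReal.ofReal (Real.exp (-m)) :=
    h3.trans (mul_le_of_le_one_left zero_le (ENNReal.rpow_le_one prob_le_one (by positivity)))
  rw [hpow]
  rwa [one_div, ENNReal.rpow_inv_le_iff hk0] at h4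

/-- Geometric tails imply an exponential moment. -/
theorem lintegral_exp_mul_max_le {α : Type*} [MeasurableSpace α] {μ : Measure α}
    [IsProbabilityMeasure μ] {X : α → ℝ} (hX : Measurable X) {a m : ℝ} (ha : 0 < a) (hm : 2 ≤ m)
    (h : ∀ k : ℕ, 1 ≤ k → μ {x | k * a ≤ X x} ≤ ENNReal.ofReal (Real.exp (-(m * k)))) :
    ∫⁻ x, ENNReal.ofReal (Real.exp (m / (2 * a) * max (X x) 0)) ∂μ ≤
      ENNReal.ofReal (2 * Real.exp (m / 2)) := by
  have hmeas : ∀ k : ℕ, MeasurableSet {x | k * a ≤ max (X x) 0} := fun k =>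
    measurableSet_le measurable_const (hX.max measurable_const)
  have htail : ∀ k : ℕ, μ {x | k * a ≤ max (X x) 0} ≤ ENNReal.ofReal (Real.exp (-(m * k))) := by
    intro k
    rcases Nat.eq_zero_or_pos k with rfl | hk
    · simp
    · refine (measure_mono fun x hx => ?_).trans (h k hk)
      have : 0 < k * a := by positivity
      exact (le_max_iff.1 (mem_ofPred.1 hx)).resolve_right (by linarith)
  -- Half the decay rate `m / a` is spent on the integrand. What remains is a geometric series of
  -- ratio `e^{-m/2}`, with sum at most 2.
  have hexp : Real.exp (-(m / 2)) ≤ 1 / 2 := by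
    rw [Real.exp_neg, inv_le_comm₀ (Real.exp_pos _) (by norm_num)]
    have := Real.add_one_le_exp (m / 2)
    linarith
  calc ∫⁻ x, ENNReal.ofReal (Real.exp (m / (2 * a) * max (X x) 0)) ∂μ
      ≤ ∫⁻ x, ∑' k : ℕ, {x | k * a ≤ max (X x) 0}.indicator
          (fun _ => ENNReal.ofReal (Real.exp (m / 2 * (k + 1)))) x ∂μ := by
        refine lintegral_mono fun x => ?_
        have hx : 0 ≤ max (X x) 0 / a := div_nonneg (le_max_right _ _) ha.le
        refine le_trans ?_ (ENNReal.le_tsum ⌊max (X x) 0 / a⌋₊)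
        rw [indicator_of_mem
          (by simpa [le_div_iff₀ ha] using (le_div_iff₀ ha).1 (Nat.floor_le hx))]
        refine ENNReal.ofReal_le_ofReal (Real.exp_le_exp.2 ?_)
        have e : m / (2 * a) * max (X x) 0 = m / 2 * (max (X x) 0 / a) := by field_simp
        rw [e]
        gcongr
        exact (Nat.lt_floor_add_one _).le
    _ = ∑' k : ℕ, ENNReal.ofReal (Real.exp (m / 2 * (k + 1))) * μ {x | k * a ≤ max (X x) 0} := by
        rw [lintegral_tsum fun k => (measurable_const.indicator (hmeas k)).aemeasurable]
        simp_rw [lintegral_indicator_const (hmeas _)]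
    _ ≤ ∑' k : ℕ, ENNReal.ofReal (Real.exp (m / 2) * Real.exp (-(m / 2)) ^ k) := by
        refine ENNReal.tsum_le_tsum fun k => (mul_le_mul_right (htail k) _).trans_eq ?_
        rw [← ENNReal.ofReal_mul (Real.exp_pos _).le, ← Real.exp_add, ← Real.exp_nat_mul,
          ← Real.exp_add]
        ring_nf
    _ = ENNReal.ofReal (Real.exp (m / 2) * (1 - Real.exp (-(m / 2)))⁻¹) := by
        rw [← tsum_geometric_of_lt_one (Real.exp_pos _).le (by linarith), ← tsum_mul_left,
          ENNReal.ofReal_tsum_of_nonneg (fun k => by positivity)]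
        exact (summable_geometric_of_lt_one (Real.exp_pos _).le (by linarith)).mul_left _
    _ ≤ ENNReal.ofReal (2 * Real.exp (m / 2)) := by
        refine ENNReal.ofReal_le_ofReal ?_
        rw [mul_comm]
        gcongr
        rw [inv_le_comm₀ (by linarith) (by norm_num)]
        linarith

/-- Some exponential moment of a linear functional under a log-concave measure is finite. -/
theorem IsLogConcaveMeasure.exists_lintegral_exp_inner_lt_top {n : ℕ}
    {μ : Measure (EuclideanSpace ℝ (Fin n))} [IsProbabilityMeasure μ]
    (hlc : IsLogConcaveMeasure μ) (y : EuclideanSpace ℝ (Fin n)) :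
    ∃ c : ℝ, 0 < c ∧ ∫⁻ x, ENNReal.ofReal (Real.exp (c * max ⟪x, y⟫ 0)) ∂μ < ∞ := by
  have hmeas : Measurable fun x : EuclideanSpace ℝ (Fin n) => ⟪x, y⟫ := by fun_prop
  have hex : ∃ a : ℝ, 0 < a ∧ μ {x | a ≤ ⟪x, y⟫} ≤
      μ {x | 0 ≤ ⟪x, y⟫} * ENNReal.ofReal (Real.exp (-2)) := by
    rcases eq_or_ne (μ {x | 0 ≤ ⟪x, y⟫}) 0 with h0 | h0
    · refine ⟨1, one_pos, le_trans (measure_mono fun x hx => ?_) (h0.le.trans zero_le)⟩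
      exact le_trans zero_le_one (mem_ofPred.1 hx)
    -- The half-spaces decrease to the empty set, so a far enough one has mass below any positive
    -- threshold.
    have hanti : Antitone fun k : ℕ => {x : EuclideanSpace ℝ (Fin n) | (k : ℝ) ≤ ⟪x, y⟫} :=
      fun k l hkl x hx => le_trans (by exact_mod_cast hkl) (mem_ofPred.1 hx)
    have hlim := tendsto_measure_iInter_atTop (μ := μ)
      (fun k : ℕ => (measurableSet_le measurable_const hmeas).nullMeasurableSet) hanti
      ⟨0, measure_ne_top _ _⟩
    have hemp : ⋂ k : ℕ, {x : EuclideanSpace ℝ (Fin n) | (k : ℝ) ≤ ⟪x, y⟫} = ∅ := by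
      ext x
      simp only [mem_iInter, mem_ofPred_eq, mem_empty_iff_false, iff_false, not_forall, not_le]
      exact exists_nat_gt _
    rw [hemp, measure_empty] at hlim
    have hpos : 0 < μ {x | 0 ≤ ⟪x, y⟫} * ENNReal.ofReal (Real.exp (-2)) :=
      ENNReal.mul_pos h0 (by simp [Real.exp_pos])
    obtain ⟨k, hk, hk1⟩ := ((hlim.eventually_lt_const hpos).and (eventually_ge_atTop 1)).exists
    exact ⟨k, by exact_mod_cast hk1, hk.le⟩
  obtain ⟨a, ha, h⟩ := hex
  exact ⟨2 / (2 * a), by positivity, (lintegral_exp_mul_max_le hmeas ha le_rfl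
    fun k hk => hlc.measure_mul_le_inner y h ha hk).trans_lt ENNReal.ofReal_lt_top⟩

/-- The norm has a finite exponential moment under a log-concave measure. -/
theorem IsLogConcaveMeasure.exists_lintegral_exp_norm_lt_top {n : ℕ}
    {μ : Measure (EuclideanSpace ℝ (Fin n))} [IsProbabilityMeasure μ]
    (hlc : IsLogConcaveMeasure μ) :
    ∃ c : ℝ, 0 < c ∧ ∫⁻ x, ENNReal.ofReal (Real.exp (c * ‖x‖)) ∂μ < ∞ := by
  classical
  let b : Fin n → EuclideanSpace ℝ (Fin n) := fun i => EuclideanSpace.single i 1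
  choose c hc hfin using fun y => hlc.exists_lintegral_exp_inner_lt_top y
  obtain ⟨d, hd, hdc⟩ : ∃ d : ℝ, 0 < d ∧ ∀ i, d ≤ c (b i) ∧ d ≤ c (-b i) := by
    have h : ∀ s : Finset (Fin n), ∃ d : ℝ, 0 < d ∧ ∀ i ∈ s, d ≤ c (b i) ∧ d ≤ c (-b i) := by
      intro s
      induction s using Finset.induction_on with
      | empty => exact ⟨1, one_pos, by simp⟩
      | insert j s hj ih =>
        obtain ⟨d, hd, h⟩ := ih
        refine ⟨min d (min (c (b j)) (c (-b j))), by simp [hd, hc], ?_⟩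
        intro i hi
        rcases Finset.mem_insert.1 hi with rfl | hi
        · simp
        · exact ⟨(min_le_left _ _).trans (h i hi).1, (min_le_left _ _).trans (h i hi).2⟩
    obtain ⟨d, hd, h⟩ := h Finset.univ
    exact ⟨d, hd, fun i => h i (Finset.mem_univ i)⟩
  have hn : (0 : ℝ) < n + 1 := by positivity
  refine ⟨d / (n + 1), by positivity, ?_⟩
  let f : EuclideanSpace ℝ (Fin n) → EuclideanSpace ℝ (Fin n) → ℝ≥0∞ := fun y x =>
    ENNReal.ofReal (Real.exp (c y * max ⟪x, y⟫ 0))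
  have hfm : ∀ y, Measurable (f y) := fun y => by
    have : Measurable fun x : EuclideanSpace ℝ (Fin n) => ⟪x, y⟫ := by fun_prop
    exact (((this.max measurable_const).const_mul _).exp).ennreal_ofReal
  -- A nonzero `x` has a coordinate with `‖x‖ ≤ (n + 1)|x i|`. The summand 1 covers `x = 0`, hence
  -- also dimension 0.
  have hle : ∀ x, ENNReal.ofReal (Real.exp (d / (n + 1) * ‖x‖)) ≤
      1 + ∑ i, (f (b i) x + f (-b i) x) := by
    intro x
    by_cases hx : ∃ i, ‖x‖ ≤ (n + 1) * |x i|
    · obtain ⟨i, hi⟩ := hx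
      have hdi : d / (n + 1) * ‖x‖ ≤ d * |x i| := by
        calc d / (n + 1) * ‖x‖ ≤ d / (n + 1) * ((n + 1) * |x i|) := by gcongr
          _ = d * |x i| := by field_simp
      have hb : ⟪x, b i⟫ = x i := by simp [b, EuclideanSpace.inner_single_right]
      have hmem : f (b i) x + f (-b i) x ≤ 1 + ∑ i, (f (b i) x + f (-b i) x) :=
        le_add_left (Finset.single_le_sum (f := fun i => f (b i) x + f (-b i) x)
          (fun _ _ => zero_le) (Finset.mem_univ i))
      refine le_trans ?_ hmem
      rcases le_total 0 (x i) with h0 | h0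
      · refine le_add_right (ENNReal.ofReal_le_ofReal (Real.exp_le_exp.2 (hdi.trans ?_)))
        rw [hb, abs_of_nonneg h0, max_eq_left h0]
        exact mul_le_mul_of_nonneg_right (hdc i).1 h0
      · refine le_add_left (ENNReal.ofReal_le_ofReal (Real.exp_le_exp.2 (hdi.trans ?_)))
        rw [inner_neg_right, hb, abs_of_nonpos h0, max_eq_left (by linarith)]
        exact mul_le_mul_of_nonneg_right (hdc i).2 (by linarith)
    · push Not at hx
      have hx0 : x = 0 := by
        by_contra hne
        have h1 : ‖x‖ ≤ ∑ i, |x i| := by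
          have hs : x = ∑ i, x i • b i := by
            ext j
            simp [b, Finset.sum_apply, Pi.single_apply]
          calc ‖x‖ = ‖∑ i, x i • b i‖ := by rw [← hs]
            _ ≤ ∑ i, ‖x i • b i‖ := norm_sum_le _ _
            _ = ∑ i, |x i| := by simp [b, norm_smul]
        have h2 : ∑ i, |x i| ≤ ∑ _i : Fin n, ‖x‖ / (n + 1) :=
          Finset.sum_le_sum fun i _ => by
            rw [le_div_iff₀ hn]; linarith [hx i]
        have h3 : ∑ _i : Fin n, ‖x‖ / (n + 1) = ‖x‖ * (n / (n + 1)) := by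
          simp; ring
        have h4 : (n : ℝ) / (n + 1) < 1 := by rw [div_lt_one hn]; linarith
        have := norm_pos_iff.2 hne
        nlinarith
      simp [hx0]
  refine (lintegral_mono hle).trans_lt ?_
  rw [lintegral_add_left measurable_const, lintegral_finsetSum (f := fun i x => f (b i) x + f (-b i) x) _
    fun i _ => (hfm (b i)).add (hfm (-b i))]
  refine ENNReal.add_lt_top.2 ⟨by simp, ENNReal.sum_lt_top.2 fun i _ => ?_⟩
  rw [lintegral_add_left (hfm _)]
  exact ENNReal.add_lt_top.2 ⟨hfin _, hfin _⟩
-- Finiteness of moments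
theorem Real.rpow_le_exp_mul {u t : ℝ} (hu : 0 ≤ u) (ht : 0 ≤ t) : u ^ t ≤ Real.exp (t * u) := by
  have h : u ≤ Real.exp u := by linarith [Real.add_one_le_exp u]
  calc u ^ t ≤ Real.exp u ^ t := Real.rpow_le_rpow hu h ht
    _ = Real.exp (t * u) := by rw [← Real.exp_mul, mul_comm]

theorem IsLogConcaveMeasure.integrable_norm_rpow {n : ℕ}
    {μ : Measure (EuclideanSpace ℝ (Fin n))} [IsProbabilityMeasure μ]
    (hlc : IsLogConcaveMeasure μ) {t : ℝ} (ht : 0 < t) : Integrable (fun x => ‖x‖ ^ t) μ := by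
  obtain ⟨c, hc, hfin⟩ := hlc.exists_lintegral_exp_norm_lt_top
  have hint : Integrable (fun x : EuclideanSpace ℝ (Fin n) => Real.exp (c * ‖x‖)) μ := by
    refine ⟨by fun_prop, ?_⟩
    rw [hasFiniteIntegral_iff_ofReal (Eventually.of_forall fun x => (Real.exp_pos _).le)]
    exact hfin
  refine (hint.const_mul ((t / c) ^ t)).mono'
    ((measurable_norm.pow_const t).aestronglyMeasurable) (Eventually.of_forall fun x => ?_)
  have h := Real.rpow_le_exp_mul (u := c / t * ‖x‖) (by positivity) ht.le
  rw [Real.norm_of_nonneg (by positivity)]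
  calc ‖x‖ ^ t = (t / c) ^ t * (c / t * ‖x‖) ^ t := by
        rw [← Real.mul_rpow (by positivity) (by positivity)]
        congr 1
        field_simp
    _ ≤ (t / c) ^ t * Real.exp (t * (c / t * ‖x‖)) := by gcongr
    _ = (t / c) ^ t * Real.exp (c * ‖x‖) := by
        congr 2
        field_simp

theorem IsLogConcaveMeasure.integrable_max_inner_rpow {n : ℕ}
    {μ : Measure (EuclideanSpace ℝ (Fin n))} [IsProbabilityMeasure μ]
    (hlc : IsLogConcaveMeasure μ) {t : ℝ} (ht : 0 < t) (y : EuclideanSpace ℝ (Fin n)) :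
    Integrable (fun x => (max ⟪x, y⟫ 0) ^ t) μ := by
  have hm : Measurable fun x : EuclideanSpace ℝ (Fin n) => ⟪x, y⟫ := by fun_prop
  refine ((hlc.integrable_norm_rpow ht).mul_const (‖y‖ ^ t)).mono'
    ((hm.max measurable_const).pow_const t).aestronglyMeasurable (Eventually.of_forall fun x => ?_)
  rw [Real.norm_of_nonneg (by positivity), ← Real.mul_rpow (norm_nonneg _) (norm_nonneg _)]
  refine Real.rpow_le_rpow (le_max_right _ _) (max_le (real_inner_le_norm _ _) (by positivity)) ht.le

theorem IsLogConcaveMeasure.integrable_inner {n : ℕ}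
    {μ : Measure (EuclideanSpace ℝ (Fin n))} [IsProbabilityMeasure μ]
    (hlc : IsLogConcaveMeasure μ) (y : EuclideanSpace ℝ (Fin n)) :
    Integrable (fun x => ⟪x, y⟫) μ := by
  refine ((hlc.integrable_norm_rpow one_pos).mul_const ‖y‖).mono' (by fun_prop)
    (Eventually.of_forall fun x => ?_)
  rw [Real.rpow_one]
  exact norm_inner_le_norm x y

/-! ### Uniform mass of half-spaces near the origin -/

/-- A centered log-concave measure is carried by a subspace in which all half-spaces at a small
fixed distance from the origin have measure bounded below. -/
theorem IsLogConcaveMeasure.exists_le_measure_halfspace {n : ℕ}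
    {μ : Measure (EuclideanSpace ℝ (Fin n))} [IsProbabilityMeasure μ]
    (hlc : IsLogConcaveMeasure μ) (hcent : IsCenteredMeasure μ) :
    ∃ (V : Submodule ℝ (EuclideanSpace ℝ (Fin n))) (δ : ℝ), (∀ᵐ x ∂μ, x ∈ V) ∧ 0 < δ ∧ δ ≤ 1 ∧
      ∀ y, ∃ y', (∀ x ∈ V, ⟪x, y⟫ = ⟪x, y'⟫) ∧
        ENNReal.ofReal δ ≤ μ {x | δ * ‖y'‖ ≤ ⟪x, y⟫} := by
  -- `K` collects the degenerate directions; `V` is its orthogonal complement.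
  let K : Submodule ℝ (EuclideanSpace ℝ (Fin n)) :=
    { carrier := {y | ∀ᵐ x ∂μ, ⟪x, y⟫ = 0}
      zero_mem' := by simp
      add_mem' := fun {a b} ha hb => by
        change ∀ᵐ x ∂μ, ⟪x, a + b⟫ = 0
        filter_upwards [mem_ofPred.1 ha, mem_ofPred.1 hb] with x h1 h2
        rw [inner_add_right, h1, h2, add_zero]
      smul_mem' := fun c a ha => by
        change ∀ᵐ x ∂μ, ⟪x, c • a⟫ = 0
        filter_upwards [mem_ofPred.1 ha] with x h1
        rw [inner_smul_right, h1, mul_zero] }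
  have hV : ∀ᵐ x ∂μ, x ∈ Kᗮ := by
    obtain ⟨S, hS⟩ := (IsNoetherian.noetherian K : K.FG)
    have hall : ∀ᵐ x ∂μ, ∀ y ∈ (S : Set (EuclideanSpace ℝ (Fin n))), ⟪x, y⟫ = 0 := by
      rw [ae_ball_iff S.countable_toSet]
      intro y hy
      have : y ∈ K := hS ▸ Submodule.subset_span hy
      exact this
    filter_upwards [hall] with x hx
    rw [Submodule.mem_orthogonal']
    intro u hu
    rw [← hS] at hu
    induction hu using Submodule.span_induction with
    | mem y hy => exact hx y hy
    | zero => simp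
    | add a b _ _ ha hb => rw [inner_add_right, ha, hb, add_zero]
    | smul c a _ ha => rw [inner_smul_right, ha, mul_zero]
  have hm : ∀ y, Measurable fun x : EuclideanSpace ℝ (Fin n) => ⟪x, y⟫ := fun y => by fun_prop
  have hb : ∀ y x : EuclideanSpace ℝ (Fin n), 0 ≤ min (max ⟪x, y⟫ 0) 1 := fun y x =>
    le_min (le_max_right _ _) zero_le_one
  have hmin : ∀ y, Integrable (fun x => min (max ⟪x, y⟫ 0) 1) μ := fun y => by
    refine (integrable_const (1 : ℝ)).mono'
      (((hm y).max measurable_const).min measurable_const).aestronglyMeasurable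
      (Eventually.of_forall fun x => ?_)
    rw [Real.norm_of_nonneg (hb y x)]
    exact min_le_right _ _
  -- Truncation at 1 gives a constant dominating function.
  have hcont : Continuous fun y => ∫ x, min (max ⟪x, y⟫ 0) 1 ∂μ := by
    refine continuous_of_dominated (bound := fun _ => 1) (fun y => (hmin y).aestronglyMeasurable)
      (fun y => Eventually.of_forall fun x => ?_) (integrable_const _)
      (Eventually.of_forall fun x => by fun_prop)
    rw [Real.norm_of_nonneg (hb y x)]
    exact min_le_right _ _
  -- If the integral vanishes, `⟨x,y⟩ ≤ 0` a.e.; centering turns this into equality, so `y ∈ K ∩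
  -- Kᗮ`.
  have hpos : ∀ y ∈ Metric.sphere 0 1 ∩ (Kᗮ : Set (EuclideanSpace ℝ (Fin n))),
      0 < ∫ x, min (max ⟪x, y⟫ 0) 1 ∂μ := by
    rintro y ⟨hy1, hyV⟩
    refine lt_of_le_of_ne (integral_nonneg (hb y)) fun h0 => ?_
    have h1 := (integral_eq_zero_iff_of_nonneg (hb y) (hmin y)).1 h0.symm
    have h2 : 0 ≤ᵐ[μ] fun x => -⟪x, y⟫ := by
      filter_upwards [h1] with x hx
      by_contra hneg
      have : 0 < ⟪x, y⟫ := by simpa using hneg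
      have h3 : 0 < min (max ⟪x, y⟫ 0) 1 := lt_min (lt_max_of_lt_left this) one_pos
      exact h3.ne' hx
    have h3 := (integral_eq_zero_iff_of_nonneg_ae h2 (hlc.integrable_inner y).neg).1
      (by rw [integral_neg, hcent y, neg_zero])
    have hyK : y ∈ K := by
      change ∀ᵐ x ∂μ, ⟪x, y⟫ = 0
      filter_upwards [h3] with x hx
      simpa using hx
    have : y = 0 := by
      have := Submodule.inner_right_of_mem_orthogonal hyK hyV
      simpa using this
    simp [this] at hy1
  obtain ⟨η, hη, hle⟩ := ((isCompact_sphere 0 1).inter_right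
    Kᗮ.closed_of_finiteDimensional).exists_forall_le' hcont.continuousOn hpos
  -- The truncated integral is at least `η` and at most `δ` plus the mass of the half-space, which
  -- is therefore at least `η - δ ≥ δ`.
  set δ := min (η / 2) 1
  have hδ : 0 < δ := lt_min (by linarith) one_pos
  have hδη : δ ≤ η / 2 := min_le_left _ _
  refine ⟨Kᗮ, δ, hV, hδ, min_le_right _ _, fun y => ?_⟩
  refine ⟨Kᗮ.starProjection y, ?_, ?_⟩
  · intro x hx
    conv_lhs => rw [← Submodule.starProjection_eq_self_iff.2 hx]
    exact Submodule.inner_starProjection_left_eq_right _ _ _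
  set y' := Kᗮ.starProjection y with hy'
  have hy'V : y' ∈ Kᗮ := Submodule.starProjection_apply_mem _ _
  have hae : ∀ᵐ x ∂μ, ⟪x, y⟫ = ⟪x, y'⟫ := by
    filter_upwards [hV] with x hx
    conv_lhs => rw [← Submodule.starProjection_eq_self_iff.2 hx]
    exact Submodule.inner_starProjection_left_eq_right _ _ _
  rcases eq_or_ne y' 0 with h0 | h0
  · calc ENNReal.ofReal δ ≤ μ univ := by simp [δ]
      _ ≤ μ {x | δ * ‖y'‖ ≤ ⟪x, y⟫} := measure_mono_ae (by
          filter_upwards [hae] with x hx _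
          change δ * ‖y'‖ ≤ ⟪x, y⟫
          simp [hx, h0])
  have hn : 0 < ‖y'‖ := norm_pos_iff.2 h0
  have hu := hle (‖y'‖⁻¹ • y') ⟨by simp [norm_smul, hn.ne'], Kᗮ.smul_mem _ hy'V⟩
  have hSm : MeasurableSet {x : EuclideanSpace ℝ (Fin n) | δ * ‖y'‖ ≤ ⟪x, y'⟫} :=
    measurableSet_le measurable_const (hm y')
  have hup : ∫ x, min (max ⟪x, ‖y'‖⁻¹ • y'⟫ 0) 1 ∂μ ≤ δ + μ.real {x | δ * ‖y'‖ ≤ ⟪x, y'⟫} := by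
    calc ∫ x, min (max ⟪x, ‖y'‖⁻¹ • y'⟫ 0) 1 ∂μ
        ≤ ∫ x, (δ + {x | δ * ‖y'‖ ≤ ⟪x, y'⟫}.indicator (fun _ => (1 : ℝ)) x) ∂μ := by
          refine integral_mono (hmin _)
            ((integrable_const δ).add ((integrable_const 1).indicator hSm)) fun x => ?_
          by_cases hx : δ * ‖y'‖ ≤ ⟪x, y'⟫
          · rw [indicator_of_mem (show x ∈ {x | δ * ‖y'‖ ≤ ⟪x, y'⟫} from hx)]
            exact (min_le_right _ _).trans (by linarith)
          · rw [indicator_of_notMem (by simpa using hx), add_zero]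
            refine (min_le_left _ _).trans (max_le ?_ hδ.le)
            rw [inner_smul_right, inv_mul_le_iff₀ hn]
            linarith
      _ = δ + μ.real {x | δ * ‖y'‖ ≤ ⟪x, y'⟫} := by
          rw [integral_add (integrable_const δ) ((integrable_const 1).indicator hSm),
            integral_indicator_const _ hSm]
          simp
  have heq : μ {x | δ * ‖y'‖ ≤ ⟪x, y⟫} = μ {x | δ * ‖y'‖ ≤ ⟪x, y'⟫} := by
    refine measure_congr ?_
    filter_upwards [hae] with x hx
    exact congrArg (fun r : ℝ => δ * ‖y'‖ ≤ r) hx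
  rw [heq, ← ofReal_measureReal]
  exact ENNReal.ofReal_le_ofReal (by linarith)

/-! ### Half-space mass, centroid bodies and the Cramer transform -/

/-- The support function of the one-sided centroid body is controlled by a tail quantile. -/
theorem IsLogConcaveMeasure.oneSidedCentroidSupport_le {n : ℕ}
    {μ : Measure (EuclideanSpace ℝ (Fin n))} [IsProbabilityMeasure μ]
    (hlc : IsLogConcaveMeasure μ) (y : EuclideanSpace ℝ (Fin n)) {t a : ℝ} (ht : 1 ≤ t)
    (ha : 0 < a) (h : μ {x | a ≤ ⟪x, y⟫} ≤
      μ {x | 0 ≤ ⟪x, y⟫} * ENNReal.ofReal (Real.exp (-(2 * t)))) :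
    oneSidedCentroidSupport μ t y ≤ 12 * a := by
  have ht0 : 0 < t := by linarith
  have hm : Measurable fun x : EuclideanSpace ℝ (Fin n) => ⟪x, y⟫ := by fun_prop
  -- With `m = 2t` the exponent is `tX/a`, which dominates `(X/a)^t`.
  have hexp := lintegral_exp_mul_max_le hm ha (m := 2 * t) (by linarith)
    fun k hk => hlc.measure_mul_le_inner y h ha hk
  have hI : ∫ x, (max ⟪x, y⟫ 0) ^ t ∂μ ≤ a ^ t * (2 * Real.exp t) := by
    rw [integral_eq_lintegral_of_nonneg_ae (Eventually.of_forall fun x => by positivity)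
      (hlc.integrable_max_inner_rpow ht0 y).aestronglyMeasurable]
    refine ENNReal.toReal_le_of_le_ofReal (by positivity) ?_
    rw [ENNReal.ofReal_mul (by positivity)]
    refine le_trans ?_ (mul_le_mul_right (hexp.trans_eq ?_) _)
    · rw [← lintegral_const_mul' _ _ ENNReal.ofReal_ne_top]
      refine lintegral_mono fun x => ?_
      rw [← ENNReal.ofReal_mul (by positivity)]
      refine ENNReal.ofReal_le_ofReal ?_
      have h0 : 0 ≤ max ⟪x, y⟫ 0 / a := div_nonneg (le_max_right _ _) ha.le
      have e : (max ⟪x, y⟫ 0) ^ t = a ^ t * (max ⟪x, y⟫ 0 / a) ^ t := by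
        rw [← Real.mul_rpow ha.le h0]
        congr 1
        field_simp
      rw [e]
      refine mul_le_mul_of_nonneg_left ((Real.rpow_le_exp_mul h0 ht0.le).trans_eq ?_)
        (by positivity)
      congr 1
      field_simp
    · congr 3
      ring
  rw [oneSidedCentroidSupport, one_div, Real.rpow_inv_le_iff_of_pos
    (mul_nonneg zero_le_two (integral_nonneg fun x => by positivity)) (by positivity) ht0]
  -- The constant is `12 = 4 · 3`: the two factors 2 are absorbed in `4 ^ t`, and `e ≤ 3`.
  have h4 : (4 : ℝ) ≤ 4 ^ t := Real.self_le_rpow_of_one_le (by norm_num) ht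
  have h3 : Real.exp t ≤ 3 ^ t := by
    rw [← Real.exp_one_rpow]
    exact Real.rpow_le_rpow (Real.exp_pos _).le (by linarith [Real.exp_one_lt_d9]) ht0.le
  calc 2 * ∫ x, (max ⟪x, y⟫ 0) ^ t ∂μ ≤ 2 * (a ^ t * (2 * Real.exp t)) := by gcongr
    _ = 4 * Real.exp t * a ^ t := by ring
    _ ≤ 4 ^ t * 3 ^ t * a ^ t := by gcongr
    _ = (12 * a) ^ t := by
        rw [← Real.mul_rpow (by norm_num) (by norm_num),
          ← Real.mul_rpow (by norm_num) ha.le]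
        norm_num

theorem cramerTransform_nonneg {n : ℕ} (μ : Measure (EuclideanSpace ℝ (Fin n)))
    [IsProbabilityMeasure μ] (x : EuclideanSpace ℝ (Fin n)) : 0 ≤ cramerTransform μ x := by
  refine le_iSup_of_le 0 ?_
  simp [logLaplace]

/-- A lower bound on the measure of all half-spaces containing `x` bounds the Cramer transform. -/
theorem cramerTransform_le_of_le_measure {n : ℕ} {μ : Measure (EuclideanSpace ℝ (Fin n))}
    {x : EuclideanSpace ℝ (Fin n)} {B : ℝ}
    (h : ∀ ξ, ENNReal.ofReal (Real.exp (-B)) ≤ μ {z | ⟪x, ξ⟫ ≤ ⟪z, ξ⟫}) :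
    cramerTransform μ x ≤ (B : EReal) := by
  refine iSup_le fun ξ => ?_
  have hlow : ENNReal.ofReal (Real.exp (⟪x, ξ⟫ - B)) ≤
      ∫⁻ z, ENNReal.ofReal (Real.exp ⟪ξ, z⟫) ∂μ := by
    refine le_trans ?_ (mul_meas_ge_le_lintegral (μ := μ) (by fun_prop)
      (ENNReal.ofReal (Real.exp ⟪x, ξ⟫)))
    rw [sub_eq_add_neg, Real.exp_add, ENNReal.ofReal_mul (Real.exp_pos _).le]
    refine mul_le_mul_right ((h ξ).trans (measure_mono fun z hz => ?_)) _
    refine ENNReal.ofReal_le_ofReal (Real.exp_le_exp.2 ?_)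
    rw [real_inner_comm z ξ]
    exact hz
  have hlog : ((⟪x, ξ⟫ - B : ℝ) : EReal) ≤ logLaplace μ ξ := by
    refine le_trans (le_of_eq ?_) (ENNReal.log_monotone hlow)
    rw [ENNReal.log_ofReal_of_pos (Real.exp_pos _), Real.log_exp]
  refine (EReal.sub_le_sub le_rfl hlog).trans (le_of_eq ?_)
  rw [← EReal.coe_sub]
  congr 1
  ring

/-! ### Integrability of the Cramer transform -/

theorem mainTheorem9 {n : ℕ} (μ : Measure (EuclideanSpace ℝ (Fin n))) [IsProbabilityMeasure μ]
    (hlc : IsLogConcaveMeasure μ) (hcent : IsCenteredMeasure μ)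
    (hrate : ∃ g : ℝ → ℝ, MonotoneOn g (Ici 1) ∧ (∀ t : ℝ, 1 ≤ t → 1 ≤ g t) ∧
      Tendsto (fun t : ℝ => g t / Real.log (t + 1)) atTop atTop ∧
      ∀ t : ℝ, 2 ≤ t → g t • oneSidedCentroidBody μ 2 ⊆ oneSidedCentroidBody μ t)
    (p : ℝ) (hp : 1 ≤ p) :
    ∫⁻ x, (cramerTransform μ x).abs ^ p ∂μ < ∞ := by
  obtain ⟨g, -, hg1, hglim, hgsub⟩ := hrate
  obtain ⟨c, hc, hcfin⟩ := hlc.exists_lintegral_exp_norm_lt_top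
  obtain ⟨V, δ, hV, hδ, hδ1, hhalf⟩ := hlc.exists_le_measure_halfspace hcent
  have hp0 : 0 < p := by linarith
  -- The constant is chosen so that `ln(t + 1) ≥ c‖x‖/p` yields `δ² g(t) ≥ 13‖x‖`.
  obtain ⟨T, hT'⟩ := ((eventually_ge_atTop (2 : ℝ)).and
    (hglim.eventually_ge_atTop (13 * p / (c * δ ^ 2)))).exists_forall_of_atTop
  have hT2 : 2 ≤ T := (hT' T le_rfl).1
  have hT := fun t ht => (hT' t ht).2
  have hlogδ : Real.log δ ≤ 0 := Real.log_nonpos hδ.le hδ1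
  -- This gives `e^{-kt} ≤ δ e^{-2t}` for `t ≥ 1`, where `δ` bounds the mass of half-spaces through
  -- 0 from below.
  set k := 2 - Real.log δ with hk
  have hk2 : 2 ≤ k := by linarith
  -- The factor 13 beats the 12 of the centroid bound. The radius `δ²` works since Markov bounds the
  -- second moment below by `δ³‖y'‖² ≥ (δ²‖y'‖)²`.
  have hbody : ∀ x ∈ V, ∀ t, 2 ≤ t → 13 * ‖x‖ ≤ δ ^ 2 * g t →
      (13 : ℝ) • x ∈ oneSidedCentroidBody μ t := by
    intro x hx t ht hxt
    have hgt : 0 < g t := by linarith [hg1 t (by linarith)]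
    refine hgsub t ht ⟨(13 / g t) • x, fun y => ?_, ?_⟩
    · obtain ⟨y', hy', hmes⟩ := hhalf y
      have hle : ⟪(13 / g t) • x, y⟫ ≤ δ ^ 2 * ‖y'‖ := by
        rw [real_inner_smul_left, hy' x hx, div_mul_eq_mul_div, div_le_iff₀ hgt]
        calc 13 * ⟪x, y'⟫ ≤ 13 * (‖x‖ * ‖y'‖) := by gcongr; exact real_inner_le_norm _ _
          _ = 13 * ‖x‖ * ‖y'‖ := by ring
          _ ≤ δ ^ 2 * g t * ‖y'‖ := by gcongr
          _ = δ ^ 2 * ‖y'‖ * g t := by ring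
      refine hle.trans ?_
      rw [oneSidedCentroidSupport, one_div, Real.le_rpow_inv_iff_of_pos (by positivity)
        (mul_nonneg zero_le_two (integral_nonneg fun x => by positivity)) two_pos]
      have hI := mul_meas_ge_le_integral_of_nonneg (μ := μ)
        (f := fun x : EuclideanSpace ℝ (Fin n) => (max ⟪x, y⟫ 0) ^ (2 : ℝ))
        (Eventually.of_forall fun x => by positivity)
        (hlc.integrable_max_inner_rpow two_pos y) ((δ * ‖y'‖) ^ (2 : ℝ))
      have hmes' : δ ≤ μ.real {x | (δ * ‖y'‖) ^ (2 : ℝ) ≤ (max ⟪x, y⟫ 0) ^ (2 : ℝ)} := by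
        rw [Measure.real, ← ENNReal.ofReal_le_iff_le_toReal (measure_ne_top _ _)]
        refine hmes.trans (measure_mono fun z hz => ?_)
        exact Real.rpow_le_rpow (by positivity) (le_max_of_le_left hz) zero_le_two
      simp only [Real.rpow_two] at hI hmes' ⊢
      have h1 : (δ * ‖y'‖) ^ 2 * δ ≤ ∫ x, max ⟪x, y⟫ 0 ^ 2 ∂μ :=
        (mul_le_mul_of_nonneg_left hmes' (by positivity)).trans hI
      have h2 : (δ ^ 2 * ‖y'‖) ^ 2 ≤ (δ * ‖y'‖) ^ 2 * δ := by
        have : (δ ^ 2 * ‖y'‖) ^ 2 = (δ * ‖y'‖) ^ 2 * δ * δ := by ring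
        rw [this]
        exact mul_le_of_le_one_right (by positivity) hδ1
      have h3 : 0 ≤ (δ * ‖y'‖) ^ 2 * δ := by positivity
      linarith
    · simp only [smul_smul]
      congr 1
      field_simp
  have hcramer : ∀ x ∈ V, ∀ t, 2 ≤ t → 13 * ‖x‖ ≤ δ ^ 2 * g t →
      cramerTransform μ x ≤ ((k * t : ℝ) : EReal) := by
    intro x hx t ht hxt
    refine cramerTransform_le_of_le_measure fun ξ => ?_
    have hF0 : ENNReal.ofReal δ ≤ μ {z | 0 ≤ ⟪z, ξ⟫} := by
      obtain ⟨y', -, hmes⟩ := hhalf ξ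
      exact hmes.trans (measure_mono fun z hz => le_trans (by positivity) (mem_ofPred.1 hz))
    have hexp : Real.exp (-(k * t)) ≤ δ * Real.exp (-(2 * t)) := by
      nth_rewrite 1 [← Real.exp_log hδ]
      rw [← Real.exp_add, Real.exp_le_exp, hk]
      nlinarith
    have hexp' : ENNReal.ofReal (Real.exp (-(k * t))) ≤
        μ {z | 0 ≤ ⟪z, ξ⟫} * ENNReal.ofReal (Real.exp (-(2 * t))) := by
      refine (ENNReal.ofReal_le_ofReal hexp).trans ?_
      rw [ENNReal.ofReal_mul hδ.le]
      gcongr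
    rcases le_or_gt ⟪x, ξ⟫ 0 with ha | ha
    · refine hexp'.trans ((mul_le_of_le_one_right zero_le ?_).trans
        (measure_mono fun z hz => ha.trans hz))
      simp; linarith
    · by_contra! hlt
      have h1 := hlc.oneSidedCentroidSupport_le ξ (by linarith) ha (hlt.le.trans hexp')
      have h2 := hbody x hx t ht hxt ξ
      rw [real_inner_smul_left] at h2
      linarith
  have hbound : ∀ᵐ x ∂μ, (cramerTransform μ x).abs ^ p ≤
      ENNReal.ofReal ((k * T) ^ p) * ENNReal.ofReal (Real.exp (c * ‖x‖)) := by
    filter_upwards [hV] with x hx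
    -- For `t = T e^s`, the power `t ^ p` is `T ^ p e^{c‖x‖}`, exactly the available exponential
    -- moment.
    set s := c * ‖x‖ / p with hs
    have hs0 : 0 ≤ s := by positivity
    have hT1 : T ≤ T * Real.exp s :=
      le_mul_of_one_le_right (by linarith) (Real.one_le_exp hs0)
    have hlog : s ≤ Real.log (T * Real.exp s + 1) := by
      rw [Real.le_log_iff_exp_le (by positivity)]
      nlinarith [Real.exp_pos s]
    have hxt : 13 * ‖x‖ ≤ δ ^ 2 * g (T * Real.exp s) := by
      have h1 := hT _ hT1
      rw [le_div_iff₀ (Real.log_pos (by linarith))] at h1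
      have h2 : 13 * p / (c * δ ^ 2) * s ≤ g (T * Real.exp s) :=
        (mul_le_mul_of_nonneg_left hlog (by positivity)).trans h1
      calc 13 * ‖x‖ = δ ^ 2 * (13 * p / (c * δ ^ 2) * s) := by rw [hs]; field_simp
        _ ≤ _ := by gcongr
    have h1 := hcramer x hx _ (hT2.trans hT1) hxt
    have h0 := cramerTransform_nonneg μ x
    have habs : (cramerTransform μ x).abs ≤ ENNReal.ofReal (k * (T * Real.exp s)) := by
      lift cramerTransform μ x to ℝ using
        ⟨ne_top_of_le_ne_top (EReal.coe_ne_top _) h1, ne_bot_of_le_ne_bot EReal.zero_ne_bot h0⟩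
        with r hr
      rw [EReal.abs_def, abs_of_nonneg (by exact_mod_cast h0)]
      exact ENNReal.ofReal_le_ofReal (by exact_mod_cast h1)
    refine (ENNReal.rpow_le_rpow habs hp0.le).trans (le_of_eq ?_)
    rw [ENNReal.ofReal_rpow_of_nonneg (by positivity) hp0.le, ← mul_assoc,
      Real.mul_rpow (by positivity) (Real.exp_pos _).le, ENNReal.ofReal_mul (by positivity),
      ← Real.exp_mul]
    congr 3
    rw [hs]
    field_simp
  refine (lintegral_mono_ae hbound).trans_lt ?_
  rw [lintegral_const_mul' _ _ ENNReal.ofReal_ne_top]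
  exact ENNReal.mul_lt_top ENNReal.ofReal_lt_top hcfin
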